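/- Conventions. Cardinals are identified with initial ordinals. Let $D$ be a proper $\aleph_1$-complete filter on a cardinal $\kappa$ (closed under countable intersections). Put $D^+=\{A\subseteq\kappa:\kappa\setminus A\notin D\}$ and, for $A\in D^+$, let $D+A$ be the filter generated by $D\cup\{A\}$. Write $f<_D g$ if $\{i<\kappa:f(i)<g(i)\}\in D$. For $f:\kappa\to\mathrm{Ord}$ the norm $\|f\|_D$ is defined by recursion on the well-founded relation $<_D$ by $\|f\|_D=\sup\{\|g\|_D+1: g:\kappa\to\mathrm{Ord},\ g<_D f\}$. For cardinals $\mu_i$ $(i<\kappa)$, $\mathrm{Depth}^+(\prod_i\mu_i,<_D)$ is the least cardinal $\mu$ such that there is no $<_D$-increasing sequence of length $\mu$ in $\prod_i\mu_i$; and $\mu=\mathrm{tcf}(\prod_i\mu_i/D)$ means that $\mu$ is a regular (infinite) cardinal and there is a $<_D$-increasing sequence of length $\mu$ in $\prod_i\mu_i$ which is cofinal in $(\prod_i\mu_i,<_D)$. For a regular cardinal $\lambda$, let $J^{bd}_\lambda$ be the ideal of bounded subsets of $\lambda$. Then $\mathfrak{dp}^{3+}_\lambda$ is the least cardinal $\mu$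 such that there is no sequence $\langle A_\alpha:\alpha<\mu\rangle$ of subsets of $\lambda$ with $A_\alpha\notin J^{bd}_\lambda$ for all $\alpha<\mu$, and $A_\beta\setminus A_\alpha\notin J^{bd}_\lambda$ and $A_\alpha\setminus A_\beta\in J^{bd}_\lambda$ for all $\alpha<\beta<\mu$. And $\mathfrak a_\lambda$ is the least cardinal $\mu$ such that there is no family $\mathcal P$ of cardinality $\mu$ consisting of subsets of $\lambda$ of cardinality $\lambda$ such that $|A\cap B|<\lambda$ for all distinct $A,B\in\mathcal P$. Theorem. Let $\kappa$ be a cardinal, $D$ a proper $\aleph_1$-complete filter on $\kappa$, $\langle\lambda_i:i<\kappa\rangle$ a sequence of regular cardinals with $\lambda_i>(2^\kappa)^+$, and $\lambda$ a regular cardinal such that $\|\langle\lambda_i:i<\kappa\rangle\|_{D+A}=\lambda$ for every $A\in D^+$. Let $\mu_i$ $(i<\kappa)$ and $\mu$ be cardinals such that either $\mu=\mathrm{tcf}(\prod_{i<\kappa}\mu_i/D)$, or $\mu<\mathrm{Depth}^+(\prod_{i<\kappa}\mu_i,<_D)$ and $\mu>2^\kappa$. (1) If $\mu_i<\mathfrak{dp}^{3+}_{\lambda_i}$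 for all $i<\kappa$, then $\mu<\mathfrak{dp}^{3+}_\lambda$. (2) If $\mu_i<\mathfrak a_{\lambda_i}$ for all $i<\kappa$, then $\mu<\mathfrak a_\lambda$. -/

import Mathlib

open Filter Cardinal

universe u v

/-- `f <_D g`: the set of indices `i` with `f i < g i` belongs to the filter `D`. -/
def ltMod {ι : Type v} {α : ι → Type*} [∀ i, LT (α i)] (D : Filter ι)
    (f g : ∀ i, α i) : Prop :=
  ∀ᶠ i in D, f i < g i

/-- Modulo a proper `ℵ₁`-complete filter, `<_D` is well founded on functions into the ordinals. -/
theorem ltMod_wellFounded {ι : Type u} (D : Filter ι) [CountableInterFilter D] [NeBot D] :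
    WellFounded (ltMod D : (ι → Ordinal.{u}) → (ι → Ordinal.{u}) → Prop) := by
  rw [wellFounded_iff_isEmpty_descending_chain]
  refine ⟨fun ⟨f, hf⟩ => ?_⟩
  have h : ∀ᶠ i in D, ∀ n, f (n + 1) i < f n i := eventually_countable_forall.2 hf
  obtain ⟨i, hi⟩ := h.exists
  exact (wellFounded_iff_isEmpty_descending_chain.1
    (wellFounded_lt : WellFounded ((· < ·) : Ordinal.{u} → Ordinal.{u} → Prop))).false
    ⟨fun n => f n i, hi⟩

instance ltMod_isWellFounded {ι : Type u} (D : Filter ι) [CountableInterFilter D] [NeBot D] :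
    IsWellFounded (ι → Ordinal.{u}) (ltMod D) :=
  ⟨ltMod_wellFounded D⟩

/-- The norm `‖f‖_D = sup {‖g‖_D + 1 : g <_D f}` of a function `f` from `ι` to the ordinals, for a
proper `ℵ₁`-complete filter `D` on `ι`. -/
noncomputable def filterNorm {ι : Type u} (D : Filter ι) [CountableInterFilter D] [NeBot D]
    (f : ι → Ordinal.{u}) : Ordinal.{u + 1} :=
  IsWellFounded.rank (ltMod D) f

theorem filterNorm_eq {ι : Type u} (D : Filter ι) [CountableInterFilter D] [NeBot D]
    (f : ι → Ordinal.{u}) :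
    filterNorm D f = ⨆ g : {g : ι → Ordinal.{u} // ltMod D g f}, Order.succ (filterNorm D g) :=
  IsWellFounded.rank_eq (ltMod D) f

/-- `Depth⁺` of a strict order `r` on `P`: the least cardinal `μ` such that there is no
`r`-increasing sequence of length `μ` in `P`. -/
noncomputable def depthPlus {P : Type u} (r : P → P → Prop) : Cardinal.{u} :=
  sInf {μ | ¬ ∃ a : μ.ord.ToType → P, ∀ α β, α < β → r (a α) (a β)}

/-- `μ = tcf (P, r)`: the cardinal `μ` is regular and there is an `r`-increasing sequence of length
`μ` in `P` that is cofinal in `P`. -/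
def HasTrueCofinality {P : Type u} (r : P → P → Prop) (μ : Cardinal.{u}) : Prop :=
  μ.IsRegular ∧ ∃ a : μ.ord.ToType → P,
    (∀ α β, α < β → r (a α) (a β)) ∧ ∀ p, ∃ α, r p (a α)

/-- The ideal `J^bd_c` of bounded subsets of the cardinal `c`. -/
def boundedIdeal (c : Cardinal.{u}) : Set (Set c.ord.ToType) :=
  {A | BddAbove A}

/-- The invariant `dp^{3+}_{c,J}` for an ideal `J` of subsets of `c`: the least cardinal `μ` such
that there is no sequence of length `μ` of `J`-positive subsets of `c` which is strictly increasing
modulo `J`. -/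
noncomputable def dpThreePlusIdeal (c : Cardinal.{u}) (J : Set (Set c.ord.ToType)) :
    Cardinal.{u} :=
  sInf {μ | ¬ ∃ A : μ.ord.ToType → Set c.ord.ToType,
    (∀ α, A α ∉ J) ∧ ∀ α β, α < β → A β \ A α ∉ J ∧ A α \ A β ∈ J}

/-- The invariant `dp^{3+}_c = dp^{3+}_{c,J^bd_c}`, for a regular cardinal `c`. -/
noncomputable def dpThreePlus (c : Cardinal.{u}) : Cardinal.{u} :=
  dpThreePlusIdeal c (boundedIdeal c)

/-- The almost disjointness number `𝔞_c`: the least cardinal `μ` such that there is no family of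
exactly `μ` subsets of `c`, all of cardinality `c`, any two distinct ones of which meet in a set of
cardinality less than `c`. -/
noncomputable def almostDisjointNumber (c : Cardinal.{u}) : Cardinal.{u} :=
  sInf {μ | ¬ ∃ P : Set (Set c.ord.ToType), #P = μ ∧ (∀ A ∈ P, #A = c) ∧
    ∀ A ∈ P, ∀ B ∈ P, A ≠ B → #(A ∩ B : Set c.ord.ToType) < c}

/-! Both parts follow from one map `Y` from products of subsets of the `lam i` to subsets of `l`,
turning "`A i \ B i` is bounded for `D`-almost all `i`", and likewise "unbounded", into the same
statement about `Y A \ Y B`. Given witnesses in each `lam i` and a `<_D`-increasing sequence `a α`,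
the sets `Y (fun i => A i (a α i))` are witnesses in `l`.

For infinite `ι`, fix a maximal family `G` of functions pairwise different modulo `D`; `Y A` codes
the pairs `(g, C)` with `C` positive and `g` in the product of `A` modulo `D + C`. Norms rank
functions in `l`. Among more than `2 ^ #ι` members of `G` two are `<_D`-comparable, so each rank is
taken at most `2 ^ #ι` times; hence there are at most `l` pairs, and few of bounded rank. Bounded
differences bound the ranks of new pairs (`mk_positiveTrace_diff_lt`); unbounded ones give new pairs
of arbitrarily large rank (`le_mk_positiveTrace_diff`). -/

/-! ### Comparable functions in large families. -/

theorem exists_ltMod_of_two_power_lt {ι J : Type u} [Infinite ι] {W : ι → Type*}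
    [∀ i, LinearOrder (W i)] [∀ i, WellFoundedLT (W i)] (D : Filter ι) (g : J → ∀ i, W i)
    (hg : ∀ j k, j ≠ k → ∀ᶠ i in D, g j i ≠ g k i) (hJ : 2 ^ #ι < #J) :
    ∃ j k, ltMod D (g j) (g k) := by
  classical
  have : Nonempty J := mk_ne_zero_iff.1 (ne_bot_of_gt hJ)
  -- `op` is a Skolem function for `Q`, and the W-type consists of the terms built from it. Their
  -- values form a set of size at most `2 ^ #ι` closed under `op`, in place of an elementary
  -- submodel closed under `#ι`-sequences.
  let Q (a : Set ι × Set ι) (x : a.1 → J) (j : J) : Prop :=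
    ∀ i : a.1, (i.1 ∈ a.2 → g j i = g (x i) i) ∧ (i.1 ∉ a.2 → g j i < g (x i) i)
  let op (a : Set ι × Set ι) (x : a.1 → J) : J := Classical.epsilon (Q a x)
  let T := WType fun a : Set ι × Set ι => a.1
  let e : T → J := WType.elim J fun p => op p.1 p.2
  have hcard : #T ≤ 2 ^ #ι := by
    apply WType.cardinalMk_le_of_le
    have h0 : ℵ₀ ≤ 2 ^ #ι := (aleph0_le_mk ι).trans (cantor _).le
    calc (sum fun a : Set ι × Set ι => ((2 : Cardinal.{u}) ^ #ι) ^ #a.1)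
        ≤ sum fun _ : Set ι × Set ι => (2 : Cardinal.{u}) ^ #ι := by
          refine sum_le_sum _ _ fun a => ?_
          rw [← power_mul]
          refine power_le_power_left two_ne_zero ?_
          exact (mul_le_mul_right (mk_set_le a.1) _).trans (mul_eq_self (aleph0_le_mk ι)).le
      _ = 2 ^ #ι := by
          simp only [sum_const', mk_prod, mk_set, lift_id]
          rw [mul_eq_self h0, mul_eq_self h0]
  obtain ⟨δ, hδ⟩ : ∃ δ, ∀ t, e t ≠ δ := by
    by_contra! h
    exact hJ.not_ge ((mk_le_of_surjective (f := e) h).trans hcard)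
  let S : Set ι := {i | ∃ t, g δ i ≤ g (e t) i}
  -- At each coordinate take the least term value that is at least `g δ i`. As `δ` satisfies the
  -- resulting instance of `Q`, so does some term; by minimality that term cannot exceed `g δ` where
  -- the two differ.
  have hw : ∀ i : S, ∃ t, g δ i ≤ g (e t) i ∧ ∀ t', g δ i ≤ g (e t') i → g (e t) i ≤ g (e t') i := by
    intro i
    let f : T → W i := fun t => g (e t) i
    obtain ⟨t, ht, hmin⟩ := (InvImage.wf f wellFounded_lt).has_min {t | g δ i ≤ g (e t) i} i.2
    exact ⟨t, ht, fun t' ht' => not_lt.1 (hmin t' ht')⟩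
  choose w hw hmin using hw
  let E : Set ι := {i | ∃ h : i ∈ S, g δ i = g (e (w ⟨i, h⟩)) i}
  have hQ : Q (S, E) (fun i => e (w i)) (e (WType.mk (S, E) w)) := by
    refine Classical.epsilon_spec (p := Q (S, E) (fun i => e (w i))) ⟨δ, fun i => ⟨?_, ?_⟩⟩
    · rintro ⟨_, h⟩
      exact h
    · intro h
      exact lt_of_le_of_ne (hw i) fun h' => h ⟨i.2, h'⟩
  refine ⟨e (WType.mk (S, E) w), δ, ?_⟩
  filter_upwards [hg _ _ (hδ (WType.mk (S, E) w))] with i hi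
  refine lt_of_le_of_ne ?_ hi
  by_contra! hlt
  have hS : i ∈ S := ⟨_, hlt.le⟩
  by_cases hE : i ∈ E
  · obtain ⟨_, h⟩ := hE
    exact hi (((hQ ⟨i, hS⟩).1 ⟨hS, h⟩).trans h.symm)
  · exact ((hQ ⟨i, hS⟩).2 hE).not_ge (hmin ⟨i, hS⟩ _ hlt.le)

/-! ### Norms and the ranks they induce. -/

section Norm

variable {ι : Type u} (D : Filter ι) [CountableInterFilter D] [NeBot D]

theorem filterNorm_lt {f g : ι → Ordinal.{u}} (h : ltMod D f g) :
    filterNorm D f < filterNorm D g :=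
  IsWellFounded.rank_lt_of_rel h

theorem exists_le_filterNorm {f : ι → Ordinal.{u}} {γ : Ordinal.{u + 1}} (h : γ < filterNorm D f) :
    ∃ g, ltMod D g f ∧ γ ≤ filterNorm D g := by
  rw [filterNorm_eq, Ordinal.lt_iSup_iff] at h
  obtain ⟨g, hg⟩ := h
  exact ⟨g, g.2, Order.lt_succ_iff.1 hg⟩

theorem filterNorm_le {f : ι → Ordinal.{u}} {γ : Ordinal.{u + 1}}
    (h : ∀ g, ltMod D g f → filterNorm D g < γ) : filterNorm D f ≤ γ := by
  by_contra! hlt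
  obtain ⟨g, hg, hle⟩ := exists_le_filterNorm D hlt
  exact hle.not_gt (h g hg)

theorem filterNorm_mono {f g : ι → Ordinal.{u}} (h : ∀ᶠ i in D, f i ≤ g i) :
    filterNorm D f ≤ filterNorm D g := by
  refine filterNorm_le D fun k hk => filterNorm_lt D ?_
  filter_upwards [h, hk] with i h₁ h₂ using h₂.trans_le h₁

/-- A larger filter has more instances of `<_D`, so ranks can only grow. -/
theorem filterNorm_anti (D' : Filter ι) [CountableInterFilter D'] [NeBot D'] (hD : D' ≤ D)
    (f : ι → Ordinal.{u}) : filterNorm D f ≤ filterNorm D' f := by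
  induction f using (ltMod_wellFounded D).induction with
  | _ f ih =>
    exact filterNorm_le D fun g hg => (ih g hg).trans_lt (filterNorm_lt D' (hD hg))

theorem lift_le_filterNorm_const (o : Ordinal.{u}) :
    Ordinal.lift.{u + 1} o ≤ filterNorm D fun _ => o := by
  induction o using WellFoundedLT.induction with
  | _ o ih =>
    by_contra! h
    obtain ⟨o', ho'⟩ := Ordinal.mem_range_lift_of_le h.le
    have hlt : o' < o := by rwa [← ho', Ordinal.lift_lt] at h
    have := (ih o' hlt).trans_lt (filterNorm_lt D (Eventually.of_forall fun _ => hlt))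
    exact this.ne ho'

theorem filterNorm_of_le_pure {s : ι} (hD : D ≤ pure s) (f : ι → Ordinal.{u}) :
    filterNorm D f = Ordinal.lift.{u + 1} (f s) := by
  have hs : ∀ᶠ i in D, i = s := hD (by simp)
  refine le_antisymm ?_ ?_
  · induction f using (ltMod_wellFounded D).induction with
    | _ f ih =>
      refine filterNorm_le D fun g hg => (ih g hg).trans_lt ?_
      obtain ⟨i, hi, rfl⟩ := (hg.and hs).exists
      exact Ordinal.lift_lt.2 hi
  · refine (lift_le_filterNorm_const D (f s)).trans (filterNorm_mono D ?_)
    filter_upwards [hs] with i hi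
    rw [hi]

end Norm

theorem bddAbove_iff_mk_lt {c : Cardinal.{u}} (hc : c.IsRegular) (S : Set c.ord.ToType) :
    BddAbove S ↔ #S < c := by
  constructor
  · rintro ⟨b, hb⟩
    refine (mk_le_mk_of_subset fun x hx => hb hx : #S ≤ #(Set.Iic b)).trans_lt ?_
    rw [← Set.Iio_insert]
    exact mk_insert_le.trans_lt
      (add_lt_of_lt hc.aleph0_le (by simpa using mk_Iio_lt b (by simp))
        (one_lt_aleph0.trans_le hc.aleph0_le))
  · intro h
    have hS : ¬ IsCofinal S := fun hS => by
      have := Order.cof_le hS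
      rw [Ordinal.cof_toType, hc.cof_ord] at this
      exact this.not_gt h
    simp only [IsCofinal, not_forall, not_exists, not_and, not_le] at hS
    obtain ⟨b, hb⟩ := hS
    exact ⟨b, fun x hx => (hb x hx).le⟩

theorem exists_forall_le {c : Cardinal.{u}} (hc : c.IsRegular) {T : Type u} (hT : #T < c)
    (f : T → c.ord.ToType) : ∃ b, ∀ t, f t ≤ b := by
  obtain ⟨b, hb⟩ := (bddAbove_iff_mk_lt hc (Set.range f)).2 (mk_range_le.trans_lt hT)
  exact ⟨b, fun t => hb ⟨t, rfl⟩⟩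

/-- `rk A` ranks `∏ i, lam i` in `l`, cofinally, along `<_{D+A}` for every `D`-positive set `A`. -/
structure IsPositiveRank {ι : Type u} (D : Filter ι) (lam : ι → Cardinal.{u}) (l : Cardinal.{u})
    (rk : Set ι → (∀ i, (lam i).ord.ToType) → l.ord.ToType) : Prop where
  lt : ∀ (A : Set ι) f g, NeBot (D ⊓ 𝓟 A) → ltMod (D ⊓ 𝓟 A) f g → rk A f < rk A g
  le : ∀ (A : Set ι) f g, NeBot (D ⊓ 𝓟 A) → (∀ᶠ i in D ⊓ 𝓟 A, f i ≤ g i) → rk A f ≤ rk A g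
  univ_le : ∀ (A : Set ι) f, NeBot (D ⊓ 𝓟 A) → rk Set.univ f ≤ rk A f
  exists_le : ∀ A : Set ι, NeBot (D ⊓ 𝓟 A) → ∀ c, ∃ f, c ≤ rk A f

theorem exists_isPositiveRank {ι : Type u} (D : Filter ι) [CountableInterFilter D] [NeBot D]
    {lam : ι → Cardinal.{u}} (hreg : ∀ i, (lam i).IsRegular) {l : Cardinal.{u}} (hl : l.IsRegular)
    (hnorm : ∀ (A : Set ι) [NeBot (D ⊓ 𝓟 A)],
      filterNorm (D ⊓ 𝓟 A) (fun i => (lam i).ord) = Ordinal.lift.{u + 1} l.ord) :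
    ∃ rk, IsPositiveRank D lam l rk := by
  classical
  have : ∀ i, Nonempty (lam i).ord.ToType := fun i =>
    mk_ne_zero_iff.1 (by simpa using (hreg i).ne_zero)
  have : Nonempty l.ord.ToType := mk_ne_zero_iff.1 (by simpa using hl.ne_zero)
  let v (f : ∀ i, (lam i).ord.ToType) (i : ι) : Ordinal.{u} := (f i).toOrd
  have hv : ∀ f i, v f i < (lam i).ord := fun f i => (f i).toOrd.2
  have hlt : ∀ f g i, v f i < v g i ↔ f i < g i := fun f g i => by simp [v]
  have hle : ∀ f g i, v f i ≤ v g i ↔ f i ≤ g i := fun f g i => by simp [v]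
  have hex : ∀ (A : Set ι) (f : ∀ i, (lam i).ord.ToType), ∃ r : l.ord.ToType,
      ∀ [NeBot (D ⊓ 𝓟 A)],
        filterNorm (D ⊓ 𝓟 A) (v f) = Ordinal.lift.{u + 1} (r.toOrd : Ordinal) := by
    intro A f
    by_cases hA : NeBot (D ⊓ 𝓟 A)
    · have h := (filterNorm_lt (D ⊓ 𝓟 A) (Eventually.of_forall (hv f))).trans_eq (hnorm A)
      obtain ⟨o, ho⟩ := Ordinal.mem_range_lift_of_le h.le
      have hol : o < l.ord := by rwa [← ho, Ordinal.lift_lt] at h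
      exact ⟨Ordinal.ToType.mk ⟨o, hol⟩, by simp [ho]⟩
    -- The rank along a non-positive set is a junk value.
    · exact ⟨Classical.arbitrary _, fun {h} => (hA h).elim⟩
  choose rk hrk using hex
  have key : ∀ (A B : Set ι) f g [NeBot (D ⊓ 𝓟 A)] [NeBot (D ⊓ 𝓟 B)],
      rk A f ≤ rk B g ↔ filterNorm (D ⊓ 𝓟 A) (v f) ≤ filterNorm (D ⊓ 𝓟 B) (v g) := by
    intro A B f g _ _
    simp [hrk]
  refine ⟨rk, ?_, ?_, ?_, ?_⟩
  · intro A f g hA h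
    rw [← not_le, key, not_le]
    exact filterNorm_lt _ (h.mono fun i hi => (hlt f g i).2 hi)
  · intro A f g hA h
    rw [key]
    exact filterNorm_mono _ (h.mono fun i hi => (hle f g i).2 hi)
  · intro A f hA
    have : NeBot (D ⊓ 𝓟 Set.univ) := by simpa
    rw [key]
    exact filterNorm_anti _ _ (by simp) _
  · intro A hA c
    have h : Ordinal.lift.{u + 1} (c.toOrd : Ordinal) <
        filterNorm (D ⊓ 𝓟 A) (fun i => (lam i).ord) := by
      rw [hnorm, Ordinal.lift_lt]
      exact c.toOrd.2
    obtain ⟨g, hg, hcg⟩ := exists_le_filterNorm _ h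
    let f : ∀ i, (lam i).ord.ToType := fun i =>
      if h : g i < (lam i).ord then Ordinal.ToType.mk ⟨g i, h⟩ else Classical.arbitrary _
    have hf : filterNorm (D ⊓ 𝓟 A) g ≤ filterNorm (D ⊓ 𝓟 A) (v f) := by
      refine filterNorm_mono _ (hg.mono fun i hi => ?_)
      simp [v, f, hi]
    refine ⟨f, ?_⟩
    have := hcg.trans hf
    rw [hrk, Ordinal.lift_le] at this
    simpa using this

/-! ### Traces on a maximal family. -/

/-- A family of functions pairwise different modulo `D`, maximal with this property. -/
theorem exists_maximal_pairwise_eventually_ne {ι : Type u} (D : Filter ι) (W : ι → Type v) :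
    ∃ G : Set (∀ i, W i), (∀ f ∈ G, ∀ g ∈ G, f ≠ g → ∀ᶠ i in D, f i ≠ g i) ∧
      ∀ [NeBot D] (f : ∀ i, W i), ∃ g ∈ G, ∃ᶠ i in D, f i = g i := by
  let r (f g : ∀ i, W i) : Prop := ∀ᶠ i in D, f i ≠ g i
  have hr : ∀ f g, r f g → r g f := fun f g h => h.mono fun i hi => hi.symm
  obtain ⟨hc, hmax⟩ := maxChain_spec (r := r)
  refine ⟨maxChain r, fun f hf g hg hne => (hc hf hg hne).elim id (hr g f), fun {_} f => ?_⟩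
  by_cases hf : f ∈ maxChain r
  · exact ⟨f, hf, (Eventually.of_forall fun _ => rfl).frequently⟩
  · by_contra! h
    have hins := hc.insert (a := f) fun b hb _ => Or.inl (by simpa [r] using h b hb)
    exact hf ((hmax hins (Set.subset_insert _ _)).symm ▸ Set.mem_insert _ _)

section Trace

variable {ι : Type u} {D : Filter ι} {lam : ι → Cardinal.{u}} {l : Cardinal.{u}}
  {rk : Set ι → (∀ i, (lam i).ord.ToType) → l.ord.ToType}
  (G : Set (∀ i, (lam i).ord.ToType))

variable (D) in
/-- The pairs `(g, C)` with `C` positive and `g ∈ ∏ i, A i` modulo `D + C`. -/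
def positiveTrace (A : ∀ i, Set (lam i).ord.ToType) : Set (G × Set ι) :=
  {x | NeBot (D ⊓ 𝓟 x.2) ∧ ∀ᶠ i in D ⊓ 𝓟 x.2, x.1.1 i ∈ A i}

/-- `<_D`-comparable functions have different ranks, so `exists_ltMod_of_two_power_lt` limits a
fibre; the coordinate `C` contributes only another factor `2 ^ #ι`. -/
theorem mk_rank_fibre_le [Infinite ι] [NeBot D] (hrk : IsPositiveRank D lam l rk)
    (hG : ∀ f ∈ G, ∀ g ∈ G, f ≠ g → ∀ᶠ i in D, f i ≠ g i) (c : l.ord.ToType) :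
    #{x : G × Set ι | rk Set.univ x.1 = c} ≤ 2 ^ #ι := by
  have h0 : ℵ₀ ≤ 2 ^ #ι := (aleph0_le_mk ι).trans (cantor _).le
  have hJ : #{g : G | rk Set.univ g = c} ≤ 2 ^ #ι := by
    by_contra! h
    obtain ⟨j, k, hjk⟩ := exists_ltMod_of_two_power_lt D
      (fun j : {g : G | rk Set.univ g = c} => j.1.1)
      (fun j k hjk => hG _ j.1.2 _ k.1.2 fun h => hjk (Subtype.ext (Subtype.ext h))) h
    have := hrk.lt Set.univ j.1 k.1 (by simpa) (by simpa using hjk)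
    rw [j.2, k.2] at this
    exact this.false
  have hprod : {x : G × Set ι | rk Set.univ x.1 = c} =
      {g : G | rk Set.univ g = c} ×ˢ (Set.univ : Set (Set ι)) := by ext; simp
  rw [hprod, mk_setProd, mk_univ, mk_set]
  exact (mul_le_mul_left hJ _).trans (mul_eq_self h0).le

theorem mk_rank_preimage_le [Infinite ι] [NeBot D] (hrk : IsPositiveRank D lam l rk)
    (hG : ∀ f ∈ G, ∀ g ∈ G, f ≠ g → ∀ᶠ i in D, f i ≠ g i) (S : Set l.ord.ToType) :
    #{x : G × Set ι | rk Set.univ x.1 ∈ S} ≤ #S * 2 ^ #ι := by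
  have : {x : G × Set ι | rk Set.univ x.1 ∈ S} =
      ⋃ c ∈ S, {x : G × Set ι | rk Set.univ x.1 = c} := by ext; simp
  rw [this]
  refine (mk_biUnion_le _ _).trans (mul_le_mul_right ?_ _)
  exact ciSup_le' fun c => mk_rank_fibre_le G hrk hG c.1

theorem mk_positiveTrace_diff_lt [Infinite ι] [NeBot D] (hrk : IsPositiveRank D lam l rk)
    (hG : ∀ f ∈ G, ∀ g ∈ G, f ≠ g → ∀ᶠ i in D, f i ≠ g i)
    (hreg : ∀ i, (lam i).IsRegular) (hl : l.IsRegular) (hιl : 2 ^ #ι < l)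
    {A B : ∀ i, Set (lam i).ord.ToType} (hAB : ∀ᶠ i in D, BddAbove (A i \ B i)) :
    #(positiveTrace D G A \ positiveTrace D G B : Set (G × Set ι)) < l := by
  have : ∀ i, Nonempty (lam i).ord.ToType := fun i =>
    mk_ne_zero_iff.1 (by simpa using (hreg i).ne_zero)
  have hb : ∀ i, ∃ b, BddAbove (A i \ B i) → ∀ x ∈ A i \ B i, x ≤ b := by
    intro i
    by_cases h : BddAbove (A i \ B i)
    · exact ⟨h.some, fun _ x hx => h.some_mem hx⟩
    · exact ⟨Classical.arbitrary _, fun h' => (h h').elim⟩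
  choose b hb using hb
  -- The positive set on which `g` leaves `B` depends on the pair, so `c` bounds the rank of `b`
  -- along all sets at once. On that set `g ≤ b`, hence the rank of `g` along `Set.univ` is at most
  -- `c`.
  obtain ⟨c, hc⟩ := exists_forall_le hl (T := Set ι) (by simpa using hιl) fun C => rk C b
  refine (mk_le_mk_of_subset (t := {x : G × Set ι | rk Set.univ x.1 ∈ Set.Iic c}) ?_).trans_lt
    ((mk_rank_preimage_le G hrk hG _).trans_lt
      (mul_lt_of_lt hl.aleph0_le ((bddAbove_iff_mk_lt hl _).1 bddAbove_Iic) hιl))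
  rintro ⟨g, C⟩ ⟨⟨hC, hA⟩, hB⟩
  have hfr : ∃ᶠ i in D ⊓ 𝓟 C, g.1 i ∉ B i := fun h => hB ⟨hC, by simpa using h⟩
  have hC' : NeBot (D ⊓ 𝓟 (C ∩ {i | g.1 i ∉ B i})) := by
    rw [← inf_principal, ← inf_assoc]
    exact frequently_mem_iff_neBot.1 hfr
  refine (hrk.univ_le _ _ hC').trans ((hrk.le _ _ b hC' ?_).trans (hc (C ∩ {i | g.1 i ∉ B i})))
  have hA' : ∀ᶠ i in D ⊓ 𝓟 (C ∩ {i | g.1 i ∉ B i}), g.1 i ∈ A i :=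
    hA.filter_mono (inf_le_inf_left _ (principal_mono.2 Set.inter_subset_left))
  filter_upwards [hA', hAB.filter_mono inf_le_left,
    mem_inf_of_right (mem_principal_self (C ∩ {i | g.1 i ∉ B i}))] with i h₁ h₂ h₃
  exact hb i h₂ _ ⟨h₁, h₃.2⟩

theorem le_mk_positiveTrace_diff [NeBot D] (hrk : IsPositiveRank D lam l rk)
    (hG : ∀ f : ∀ i, (lam i).ord.ToType, ∃ g ∈ G, ∃ᶠ i in D, f i = g i)
    (hreg : ∀ i, (lam i).IsRegular) (hι : ∀ i, 2 ^ #ι < lam i) (hl : l.IsRegular)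
    {A B : ∀ i, Set (lam i).ord.ToType} (hAB : ∀ᶠ i in D, ¬ BddAbove (B i \ A i)) :
    l ≤ #(positiveTrace D G B \ positiveTrace D G A : Set (G × Set ι)) := by
  by_contra! hlt
  obtain ⟨c, hc⟩ := exists_forall_le hl hlt fun x => rk x.1.2 x.1.1
  have hex : ∀ C : Set ι, ∃ f, NeBot (D ⊓ 𝓟 C) → c ≤ rk C f := by
    intro C
    by_cases hC : NeBot (D ⊓ 𝓟 C)
    · exact (hrk.exists_le C hC c).imp fun f hf _ => hf
    · exact ⟨fun i => (mk_ne_zero_iff.1 (by simpa using (hreg i).ne_zero) :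
        Nonempty (lam i).ord.ToType).some, fun h => (hC h).elim⟩
  choose h hh using hex
  -- The set `C` where `f` meets a member of `G` is known only after `f` is chosen, so `H` dominates
  -- every `h C`. Choosing `f` in `B \ A` above `H` then gives a pair in the difference with rank
  -- beyond `c`.
  choose H hH using fun i => exists_forall_le (hreg i) (T := Set ι) (by simpa using hι i)
    fun C => h C i
  have hf : ∀ i, ∃ x, ¬ BddAbove (B i \ A i) → x ∈ B i \ A i ∧ H i < x := by
    intro i
    by_cases hi : BddAbove (B i \ A i)
    · exact ⟨H i, fun h' => (h' hi).elim⟩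
    · obtain ⟨x, hx, hHx⟩ := not_bddAbove_iff.1 hi (H i)
      exact ⟨x, fun _ => ⟨hx, hHx⟩⟩
  choose f hf using hf
  obtain ⟨g, hg, hfg⟩ := hG f
  let C : Set ι := {i | f i = g i}
  have hC : NeBot (D ⊓ 𝓟 C) := frequently_mem_iff_neBot.1 hfg
  have hfC : ∀ᶠ i in D ⊓ 𝓟 C, f i = g i := mem_inf_of_right (mem_principal_self C)
  have hABC : ∀ᶠ i in D ⊓ 𝓟 C, ¬ BddAbove (B i \ A i) := hAB.filter_mono inf_le_left
  have hx : ((⟨g, hg⟩, C) : G × Set ι) ∈ positiveTrace D G B \ positiveTrace D G A := by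
    refine ⟨⟨hC, ?_⟩, fun hA => ?_⟩
    · filter_upwards [hfC, hABC] with i h₁ h₂
      exact h₁ ▸ (hf i h₂).1.1
    · obtain ⟨i, h₁, h₂, h₃⟩ := (hA.2.and (hfC.and hABC)).exists
      exact (hf i h₃).1.2 (h₂ ▸ h₁)
  have h₁ : rk C g ≤ c := hc ⟨_, hx⟩
  have h₂ : rk C H < rk C f := hrk.lt C _ _ hC (hABC.mono fun i hi => (hf i hi).2)
  have h₃ : rk C f ≤ rk C g := hrk.le C _ _ hC (hfC.mono fun i hi => hi.le)
  have h₄ : rk C (h C) ≤ rk C H := hrk.le C _ _ hC (Eventually.of_forall fun i => hH i C)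
  exact (h₁.trans_lt ((hh C hC).trans_lt (h₄.trans_lt (h₂.trans_le h₃)))).false

end Trace

/-! ### The transfer map. -/

/-- A map from products of subsets of the `lam i` to subsets of `l` that carries inclusions and
non-inclusions modulo bounded sets, valid `D`-almost everywhere, to the same relations in `l`. -/
structure IsBoundedTransfer {ι : Type u} (D : Filter ι) (lam : ι → Cardinal.{u}) (l : Cardinal.{u})
    (Y : (∀ i, Set (lam i).ord.ToType) → Set l.ord.ToType) : Prop where
  bddAbove : ∀ A B, (∀ᶠ i in D, BddAbove (A i \ B i)) → BddAbove (Y A \ Y B)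
  not_bddAbove : ∀ A B, (∀ᶠ i in D, ¬ BddAbove (A i \ B i)) → ¬ BddAbove (Y A \ Y B)
  empty : Y (fun _ => ∅) = ∅
  inter_subset : ∀ A B, Y A ∩ Y B ⊆ Y A \ Y fun i => (B i)ᶜ

/-- Some singleton `{s}` is positive, and the norm along `D + {s}` is evaluation at `s`. Hence `l =
lam s`, and the map is the projection to coordinate `s`. -/
theorem exists_isBoundedTransfer_of_finite {ι : Type u} [Finite ι] (D : Filter ι) [NeBot D]
    [CountableInterFilter D] {lam : ι → Cardinal.{u}} {l : Cardinal.{u}}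
    (hnorm : ∀ (A : Set ι) [NeBot (D ⊓ 𝓟 A)],
      filterNorm (D ⊓ 𝓟 A) (fun i => (lam i).ord) = Ordinal.lift.{u + 1} l.ord) :
    ∃ Y, IsBoundedTransfer D lam l Y := by
  obtain ⟨s, hs⟩ := Ultrafilter.eq_pure_of_finite (Ultrafilter.of D)
  have hsD : pure s ≤ D := by
    have := Ultrafilter.of_le D
    rwa [hs] at this
  have : NeBot (D ⊓ 𝓟 {s}) := neBot_of_le (f := pure s) (le_inf hsD (by simp))
  have h := hnorm {s}
  rw [filterNorm_of_le_pure (s := s) _ (by simp), Ordinal.lift_inj, ord_inj] at h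
  subst h
  exact ⟨fun A => A s, fun A B h => h.filter_mono hsD, fun A B h => h.filter_mono hsD, rfl,
    fun A B x hx => ⟨hx.1, fun h => h hx.2⟩⟩

theorem exists_isBoundedTransfer_of_infinite {ι : Type u} [Infinite ι] (D : Filter ι) [NeBot D]
    [CountableInterFilter D] {lam : ι → Cardinal.{u}} (hreg : ∀ i, (lam i).IsRegular)
    (hι : ∀ i, 2 ^ #ι < lam i) {l : Cardinal.{u}} (hl : l.IsRegular)
    (hnorm : ∀ (A : Set ι) [NeBot (D ⊓ 𝓟 A)],
      filterNorm (D ⊓ 𝓟 A) (fun i => (lam i).ord) = Ordinal.lift.{u + 1} l.ord) :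
    ∃ Y, IsBoundedTransfer D lam l Y := by
  have hιl : 2 ^ #ι < l := by
    have : NeBot (D ⊓ 𝓟 Set.univ) := by simpa
    have h := (lift_le_filterNorm_const (D ⊓ 𝓟 Set.univ) ((2 : Cardinal.{u}) ^ #ι).ord).trans_lt
      (filterNorm_lt (g := fun i => (lam i).ord) (D ⊓ 𝓟 Set.univ)
        (Eventually.of_forall fun i => ord_lt_ord.2 (hι i)))
    rwa [hnorm, Ordinal.lift_lt, ord_lt_ord] at h
  obtain ⟨rk, hrk⟩ := exists_isPositiveRank D hreg hl hnorm
  obtain ⟨G, hG, hGD⟩ := exists_maximal_pairwise_eventually_ne D fun i => (lam i).ord.ToType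
  have hX : #(G × Set ι) ≤ #l.ord.ToType := by
    have := mk_rank_preimage_le G hrk hG Set.univ
    simp only [Set.mem_univ, Set.ofPred_true, mk_univ, mk_ord_toType] at this
    rw [mk_ord_toType]
    exact this.trans (mul_le_of_le hl.aleph0_le le_rfl hιl.le)
  obtain ⟨e⟩ := hX
  have himage : ∀ A B, e '' positiveTrace D G A \ e '' positiveTrace D G B =
      e '' (positiveTrace D G A \ positiveTrace D G B) := fun A B =>
    (Set.image_sdiff e.injective _ _).symm
  refine ⟨fun A => e '' positiveTrace D G A, fun A B h => ?_, fun A B h => ?_, ?_, fun A B => ?_⟩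
  · rw [himage, bddAbove_iff_mk_lt hl, mk_image_eq e.injective]
    exact mk_positiveTrace_diff_lt G hrk hG hreg hl hιl h
  · rw [himage, bddAbove_iff_mk_lt hl, mk_image_eq e.injective, not_lt]
    exact le_mk_positiveTrace_diff G hrk hGD hreg hι hl h
  · rw [Set.image_eq_empty, Set.eq_empty_iff_forall_notMem]
    rintro x ⟨hx, h⟩
    exact h.exists.elim fun _ => id
  · rw [himage, ← Set.image_inter e.injective]
    refine Set.image_mono fun x hx => ⟨hx.1, fun h => ?_⟩
    have := hx.1.1
    obtain ⟨i, hi⟩ := (hx.2.2.and h.2).exists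
    exact hi.2 hi.1

/-! ### Transferring witnesses to `l`. -/

/-- A sequence of length `μ` of unbounded sets, strictly increasing modulo bounded sets, witnesses
`μ < 𝔡𝔭^{3+}_c`. -/
theorem lt_dpThreePlus {c μ : Cardinal.{u}} {A : μ.ord.ToType → Set c.ord.ToType}
    (hA : ∀ α, ¬ BddAbove (A α))
    (hlt : ∀ α β, α < β → ¬ BddAbove (A β \ A α) ∧ BddAbove (A α \ A β)) :
    μ < dpThreePlus c := by
  by_contra! hle
  refine csInf_mem (s := {μ : Cardinal.{u} | ¬ ∃ A : μ.ord.ToType → Set c.ord.ToType,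
    (∀ α, A α ∉ boundedIdeal c) ∧
      ∀ α β, α < β → A β \ A α ∉ boundedIdeal c ∧ A α \ A β ∈ boundedIdeal c})
    -- No witness has length above `2 ^ c`, so the infimum is attained; a witness of length at least
    -- the infimum would restrict to one of exactly that length.
    ⟨Order.succ ((2 : Cardinal.{u}) ^ c), ?_⟩ ?_
  · rintro ⟨B, hB, hB'⟩
    have hne : ∀ α β, α < β → B α ≠ B β := fun α β h heq => by
      have hb := hB' α β h
      rw [heq, Set.sdiff_self] at hb
      exact hb.1 hb.2
    have hinj : Function.Injective B := fun α β heq => by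
      by_contra h
      exact (lt_or_gt_of_ne h).elim (fun h => hne α β h heq) fun h => hne β α h heq.symm
    have := mk_le_of_injective hinj
    rw [mk_ord_toType, mk_set, mk_ord_toType] at this
    exact this.not_gt (Order.lt_succ _)
  · obtain ⟨f⟩ := Ordinal.type_le_iff.1 (by simpa using hle :
      Ordinal.type (α := (dpThreePlus c).ord.ToType) (· < ·) ≤
        Ordinal.type (α := μ.ord.ToType) (· < ·))
    exact ⟨fun α => A (f α), fun α => hA _, fun α β h => hlt _ _ (f.strictMono h)⟩

theorem lt_almostDisjointNumber {c μ : Cardinal.{u}} {P : Set (Set c.ord.ToType)} (hμ : #P = μ)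
    (hP : ∀ A ∈ P, #A = c) (hPP : ∀ A ∈ P, ∀ B ∈ P, A ≠ B → #(A ∩ B : Set c.ord.ToType) < c) :
    μ < almostDisjointNumber c := by
  by_contra! hle
  refine csInf_mem (s := {μ : Cardinal.{u} | ¬ ∃ P : Set (Set c.ord.ToType), #P = μ ∧
    (∀ A ∈ P, #A = c) ∧ ∀ A ∈ P, ∀ B ∈ P, A ≠ B → #(A ∩ B : Set c.ord.ToType) < c})
    ⟨Order.succ ((2 : Cardinal.{u}) ^ c), ?_⟩ ?_
  · rintro ⟨Q, hQ, -⟩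
    have := mk_set_le Q
    rw [hQ, mk_set, mk_ord_toType] at this
    exact this.not_gt (Order.lt_succ _)
  · obtain ⟨Q, hQP, hQ⟩ := (le_mk_iff_exists_subset (s := P)).1 (hμ ▸ hle)
    exact ⟨Q, hQ, fun A hA => hP A (hQP hA), fun A hA B hB => hPP A (hQP hA) B (hQP hB)⟩

theorem lt_dpThreePlus_of_transfer {ι : Type u} {D : Filter ι} {lam : ι → Cardinal.{u}}
    {l : Cardinal.{u}} {Y : (∀ i, Set (lam i).ord.ToType) → Set l.ord.ToType}
    (hY : IsBoundedTransfer D lam l Y) {mu : ι → Cardinal.{u}} {m : Cardinal.{u}}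
    {a : m.ord.ToType → ∀ i, (mu i).ord.ToType} (ha : ∀ α β, α < β → ltMod D (a α) (a β))
    (hmu : ∀ i, mu i < dpThreePlus (lam i)) : m < dpThreePlus l := by
  have h : ∀ i, ∃ A : (mu i).ord.ToType → Set (lam i).ord.ToType, (∀ α, ¬ BddAbove (A α)) ∧
      ∀ α β, α < β → ¬ BddAbove (A β \ A α) ∧ BddAbove (A α \ A β) :=
    fun i => not_not.1 (notMem_of_lt_csInf' (hmu i))
  choose A hA hlt using h
  refine lt_dpThreePlus (A := fun α => Y fun i => A i (a α i)) (fun α => ?_) fun α β h => ⟨?_, ?_⟩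
  · have := hY.not_bddAbove (fun i => A i (a α i)) (fun _ => ∅) (by simp [hA])
    rwa [hY.empty, Set.sdiff_empty] at this
  · exact hY.not_bddAbove _ _ ((ha α β h).mono fun i hi => (hlt i _ _ hi).1)
  · exact hY.bddAbove _ _ ((ha α β h).mono fun i hi => (hlt i _ _ hi).2)

theorem lt_almostDisjointNumber_of_transfer {ι : Type u} {D : Filter ι} {lam : ι → Cardinal.{u}}
    (hreg : ∀ i, (lam i).IsRegular) {l : Cardinal.{u}} (hl : l.IsRegular)
    {Y : (∀ i, Set (lam i).ord.ToType) → Set l.ord.ToType}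
    (hY : IsBoundedTransfer D lam l Y) {mu : ι → Cardinal.{u}} {m : Cardinal.{u}}
    {a : m.ord.ToType → ∀ i, (mu i).ord.ToType} (ha : ∀ α β, α < β → ltMod D (a α) (a β))
    (hmu : ∀ i, mu i < almostDisjointNumber (lam i)) : m < almostDisjointNumber l := by
  have h : ∀ i, ∃ A : (mu i).ord.ToType → Set (lam i).ord.ToType, (∀ α, ¬ BddAbove (A α)) ∧
      ∀ α β, α ≠ β → BddAbove (A α ∩ A β) := by
    intro i
    obtain ⟨P, hP, hPc, hPP⟩ := not_not.1 (notMem_of_lt_csInf' (hmu i))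
    obtain ⟨e⟩ : Nonempty ((mu i).ord.ToType ≃ P) := Cardinal.eq.1 (by simp [hP])
    refine ⟨fun α => e α, fun α => ?_, fun α β hne => ?_⟩
    · rw [bddAbove_iff_mk_lt (hreg i), hPc _ (e α).2]
      exact lt_irrefl _
    · rw [bddAbove_iff_mk_lt (hreg i)]
      exact hPP _ (e α).2 _ (e β).2 fun h => hne (e.injective (Subtype.ext h))
  choose A hA hAA using h
  let Z (α : m.ord.ToType) : Set l.ord.ToType := Y fun i => A i (a α i)
  have hZ : ∀ α, ¬ BddAbove (Z α) := fun α => by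
    have := hY.not_bddAbove (fun i => A i (a α i)) (fun _ => ∅) (by simp [hA])
    rwa [hY.empty, Set.sdiff_empty] at this
  have hZlt : ∀ α β, α < β → BddAbove (Z α ∩ Z β) := fun α β h => by
    -- Complements turn bounded intersections into bounded differences, which `Y` respects.
    refine (hY.bddAbove _ _ ((ha α β h).mono fun i hi => ?_)).mono (hY.inter_subset _ _)
    rw [Set.sdiff_compl]
    exact hAA i _ _ hi.ne
  have hZZ : ∀ α β, α ≠ β → BddAbove (Z α ∩ Z β) := fun α β hne => by
    rcases hne.lt_or_gt with h | h
    · exact hZlt α β h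
    · exact Set.inter_comm (Z β) (Z α) ▸ hZlt β α h
  -- Each `Z α` is unbounded, so repetition would contradict almost disjointness; the range thus has
  -- exactly `m` members.
  have hinj : Function.Injective Z := fun α β heq => by
    by_contra hne
    have := hZZ α β hne
    rw [heq, Set.inter_self] at this
    exact hZ β this
  refine lt_almostDisjointNumber (P := Set.range Z) ?_ ?_ ?_
  · rw [mk_range_eq _ hinj, mk_ord_toType]
  · rintro _ ⟨α, rfl⟩
    refine le_antisymm ((mk_set_le _).trans_eq (mk_ord_toType l)) ?_
    rw [← not_lt, ← bddAbove_iff_mk_lt hl]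
    exact hZ α
  · rintro _ ⟨α, rfl⟩ _ ⟨β, rfl⟩ hne
    exact (bddAbove_iff_mk_lt hl _).1 (hZZ α β fun h => hne (h ▸ rfl))

theorem theorem5p5
    (κ : Cardinal.{u}) (D : Filter κ.ord.ToType) [NeBot D] [CountableInterFilter D]
    (lam : κ.ord.ToType → Cardinal.{u})
    (hreg : ∀ i, (lam i).IsRegular)
    (hlam : ∀ i, Order.succ ((2 : Cardinal.{u}) ^ κ) < lam i)
    (l : Cardinal.{u}) (hl : l.IsRegular)
    -- `D ⊓ 𝓟 A` is the filter `D + A`; it is proper exactly when `A` is `D`-positive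
    (hnorm : ∀ (A : Set κ.ord.ToType) [NeBot (D ⊓ 𝓟 A)],
      filterNorm (D ⊓ 𝓟 A) (fun i => (lam i).ord) = Ordinal.lift.{u + 1} l.ord)
    (mu : κ.ord.ToType → Cardinal.{u}) (m : Cardinal.{u})
    (hm : HasTrueCofinality (ltMod D (α := fun i => (mu i).ord.ToType)) m ∨
      (m < depthPlus (ltMod D (α := fun i => (mu i).ord.ToType)) ∧ 2 ^ κ < m)) :
    ((∀ i, mu i < dpThreePlus (lam i)) → m < dpThreePlus l) ∧
    ((∀ i, mu i < almostDisjointNumber (lam i)) → m < almostDisjointNumber l) := by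
  obtain ⟨a, ha⟩ : ∃ a : m.ord.ToType → ∀ i, (mu i).ord.ToType,
      ∀ α β, α < β → ltMod D (a α) (a β) := by
    rcases hm with ⟨-, a, ha, -⟩ | ⟨h, -⟩
    · exact ⟨a, ha⟩
    · exact not_not.1 (notMem_of_lt_csInf' h)
  obtain ⟨Y, hY⟩ : ∃ Y, IsBoundedTransfer D lam l Y := by
    cases finite_or_infinite κ.ord.ToType
    · exact exists_isBoundedTransfer_of_finite D hnorm
    · refine exists_isBoundedTransfer_of_infinite D hreg (fun i => ?_) hl hnorm
      rw [mk_ord_toType]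
      exact (Order.lt_succ _).trans (hlam i)
  exact ⟨lt_dpThreePlus_of_transfer hY ha, lt_almostDisjointNumber_of_transfer hreg hl hY ha⟩
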